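/- Let $p>0$ be an integer and let $E_p=SU(3)/\!/S^1$ be the Eschenburg space, the quotient of $SU(3)$ by the circle action $z\cdot A=\mathrm{diag}(z,z,z^p)\,A\,\mathrm{diag}(1,1,z^{p+2})^{-1}$, $z\in U(1)$. Let $G=SU(2)\times SU(2)$ act on $E_p$ by $(g_1,g_2)\cdot[A]=[\mathrm{diag}(g_1,1)\,A\,\mathrm{diag}(g_2,1)^{-1}]$. Put $$H=\{((\pm\mathrm{id})^{p+1},(\pm\mathrm{id})^{p})\}\ \text{(same sign in both entries)},\qquad K^-=\Delta SU(2)\cdot H,$$ $$K^+=S^1_{(p+1,p)}=\{(\mathrm{diag}(z^{p+1},\bar z^{\,p+1}),\mathrm{diag}(z^{p},\bar z^{\,p})) : z\in U(1)\},$$ where $\Delta SU(2)=\{(g,g)\}$. Then: 1. $H\cong\mathbb Z_2$, and $H$ is the principal isotropy group of the action: a subgroup $K\subset G$ is an isotropy group of maximal orbit type (it is an isotropy group and every isotropy group contains a conjugate of it) if and only if $K=H$. 2. The pairs of diagonal matrices form a maximal torus of $G$; it contains $K^+$, and $z\mapsto(\mathrm{diag}(z^{p+1},\bar z^{\,p+1}),\mathrm{diag}(z^{p},\bar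 z^{\,p}))$ is injective. 3. The singular isotropy groups (isotropy groups of orbits of dimension less than that of the principal orbits) are exactly the conjugates of $K^-$ and of $K^+$. 4. The action has cohomogeneity one with group diagram $H\subset\{K^-,K^+\}\subset G$: for every metric on $E_p$ induced by a left invariant metric on $SU(3)$ that is $\mathrm{Ad}(K)$-invariant, $K=S(U(2)U(1))$, there are $L>0$ and a unit speed curve $c:[0,L]\to E_p$ that is a minimal geodesic between the orbits $G\cdot c(0)$ and $G\cdot c(L)$, such that $t\mapsto G\cdot c(t)$ is a homeomorphism from $[0,L]$ onto $E_p/G$, and the isotropy groups are $G_{c(0)}=K^-$, $G_{c(L)}=K^+$ and $G_{c(t)}=H$ for $0<t<L$. -/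

import Mathlib

open scoped ENNReal

namespace CohomOne

noncomputable section

/-! ## Groups -/

abbrev SU2 : Type := Matrix.specialUnitaryGroup (Fin 2) ℂ

abbrev SU3 : Type := Matrix.specialUnitaryGroup (Fin 3) ℂ

/-- The group `SU(2) × SU(2)`. -/
abbrev G : Type := SU2 × SU2

/-- The upper left block embedding `g ↦ diag(g, 1)` of `2 × 2` matrices in `3 × 3` matrices. -/
def blockMatrix (g : Matrix (Fin 2) (Fin 2) ℂ) : Matrix (Fin 3) (Fin 3) ℂ :=
  !![g 0 0, g 0 1, 0;
     g 1 0, g 1 1, 0;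
     0, 0, 1]

theorem blockMatrix_one : blockMatrix 1 = 1 := by
  ext i j; fin_cases i <;> fin_cases j <;> simp [blockMatrix]

theorem blockMatrix_mul (g h : Matrix (Fin 2) (Fin 2) ℂ) :
    blockMatrix (g * h) = blockMatrix g * blockMatrix h := by
  ext i j
  fin_cases i <;> fin_cases j <;>
    simp [blockMatrix, Matrix.mul_apply, Fin.sum_univ_two, Fin.sum_univ_three]

theorem blockMatrix_star (g : Matrix (Fin 2) (Fin 2) ℂ) :
    blockMatrix (star g) = star (blockMatrix g) := by
  ext i j; fin_cases i <;> fin_cases j <;> simp [blockMatrix, Matrix.star_apply]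

theorem blockMatrix_det (g : Matrix (Fin 2) (Fin 2) ℂ) : (blockMatrix g).det = g.det := by
  simp [blockMatrix, Matrix.det_fin_three, Matrix.det_fin_two]

theorem blockMatrix_mem (g : SU2) :
    blockMatrix g.1 ∈ Matrix.specialUnitaryGroup (Fin 3) ℂ := by
  obtain ⟨h1, h2⟩ := Matrix.mem_specialUnitaryGroup_iff.1 g.2
  refine Matrix.mem_specialUnitaryGroup_iff.2 ⟨?_, by rw [blockMatrix_det, h2]⟩
  rw [Matrix.mem_unitaryGroup_iff] at h1 ⊢
  rw [← blockMatrix_star, ← blockMatrix_mul, h1, blockMatrix_one]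

/-- The embedding `SU(2) → SU(3)`, `g ↦ diag(g, 1)`. -/
def block : SU2 →* SU3 where
  toFun g := ⟨blockMatrix g.1, blockMatrix_mem g⟩
  map_one' := Subtype.ext blockMatrix_one
  map_mul' g h := Subtype.ext (blockMatrix_mul g.1 h.1)

/-! ## Eschenburg spaces -/

/-- The diagonal matrix `diag(z ^ a₁, z ^ a₂, z ^ a₃)`. -/
def circleDiag (a : Fin 3 → ℤ) (z : Circle) : Matrix (Fin 3) (Fin 3) ℂ :=
  Matrix.diagonal fun i => ((z ^ a i : Circle) : ℂ)

theorem circleDiag_one (a : Fin 3 → ℤ) : circleDiag a 1 = 1 := by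
  simp [circleDiag]

theorem circleDiag_mul (a : Fin 3 → ℤ) (z w : Circle) :
    circleDiag a (z * w) = circleDiag a z * circleDiag a w := by
  simp [circleDiag, Matrix.diagonal_mul_diagonal, mul_zpow]

/-- The orbit relation of the circle action
`z · A = diag(z ^ a₁, z ^ a₂, z ^ a₃) A diag(z ^ b₁, z ^ b₂, z ^ b₃)⁻¹` on `SU(3)`. -/
def eschenburgSetoid (a b : Fin 3 → ℤ) : Setoid SU3 where
  r A B := ∃ z : Circle, B.1 = circleDiag a z * A.1 * circleDiag b z⁻¹
  iseqv :=
    { refl := fun A => ⟨1, by simp [circleDiag_one]⟩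
      symm := by
        rintro A B ⟨z, h⟩
        refine ⟨z⁻¹, ?_⟩
        have e1 : circleDiag a z⁻¹ * circleDiag a z = 1 := by
          rw [← circleDiag_mul, inv_mul_cancel, circleDiag_one]
        have e2 : circleDiag b z⁻¹ * circleDiag b z⁻¹⁻¹ = 1 := by
          rw [← circleDiag_mul, mul_inv_cancel, circleDiag_one]
        calc A.1 = (circleDiag a z⁻¹ * circleDiag a z) * A.1 *
              (circleDiag b z⁻¹ * circleDiag b z⁻¹⁻¹) := by rw [e1, e2]; simp
          _ = _ := by rw [h]; simp only [mul_assoc]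
      trans := by
        rintro A B C ⟨z, h⟩ ⟨w, k⟩
        refine ⟨w * z, ?_⟩
        rw [k, h, mul_inv_rev, circleDiag_mul, circleDiag_mul]
        simp only [mul_assoc] }

/-- The biquotient `SU(3) // S¹_{a,b}`, with the quotient topology. -/
def EschenburgSpace (a b : Fin 3 → ℤ) : Type := Quotient (eschenburgSetoid a b)

instance (a b : Fin 3 → ℤ) : TopologicalSpace (EschenburgSpace a b) :=
  inferInstanceAs (TopologicalSpace (Quotient (eschenburgSetoid a b)))

/-- `E_p = SU(3) // S¹_{a,b}` with `a = (1, 1, p)` and `b = (0, 0, p + 2)`. -/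
abbrev E (p : ℤ) : Type := EschenburgSpace ![1, 1, p] ![0, 0, p + 2]

/-- The projection `SU(3) → E_p`. -/
def proj (p : ℤ) (A : SU3) : E p := Quotient.mk (eschenburgSetoid ![1, 1, p] ![0, 0, p + 2]) A

theorem block_comm_left (p : ℤ) (z : Circle) (g : Matrix (Fin 2) (Fin 2) ℂ) :
    blockMatrix g * circleDiag ![1, 1, p] z = circleDiag ![1, 1, p] z * blockMatrix g := by
  ext i j
  fin_cases i <;> fin_cases j <;>
    simp [blockMatrix, circleDiag, Matrix.mul_diagonal, Matrix.diagonal_mul, mul_comm]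

theorem block_comm_right (q : ℤ) (z : Circle) (g : Matrix (Fin 2) (Fin 2) ℂ) :
    blockMatrix g * circleDiag ![0, 0, q] z = circleDiag ![0, 0, q] z * blockMatrix g := by
  ext i j
  fin_cases i <;> fin_cases j <;>
    simp [blockMatrix, circleDiag, Matrix.mul_diagonal, Matrix.diagonal_mul]

/-- The action of `SU(2) × SU(2)` on `E_p` induced by
`(g₁, g₂) · A = diag(g₁, 1) A diag(g₂, 1)⁻¹` on `SU(3)`. -/
instance (p : ℤ) : MulAction G (E p) where
  smul g := Quotient.map (fun A : SU3 => block g.1 * A * (block g.2)⁻¹) (by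
    rintro A B ⟨z, h⟩
    refine ⟨z, ?_⟩
    have hl := block_comm_left p z g.1.1
    have hr := block_comm_right (p + 2) z⁻¹ (g.2⁻¹).1
    rw [← map_inv]
    change blockMatrix g.1.1 * B.1 * blockMatrix (g.2⁻¹).1 =
      _ * (blockMatrix g.1.1 * A.1 * blockMatrix (g.2⁻¹).1) * _
    rw [h]
    simp only [mul_assoc, hr]
    simp only [← mul_assoc, hl])
  one_smul := by
    rintro ⟨A⟩
    exact congrArg (proj p) (by simp)
  mul_smul := by
    rintro g h ⟨A⟩
    exact congrArg (proj p) (by simp [mul_assoc])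

/-! ## Principal and singular isotropy groups

Isotropy groups are the stabilizers `MulAction.stabilizer G x`. -/

section Isotropy

variable {Γ : Type*} [Group Γ]

/-- The conjugate `g K g⁻¹`. -/
def conj (g : Γ) (K : Subgroup Γ) : Subgroup Γ := K.map (MulAut.conj g).toMonoidHom

/-- `K` is an isotropy group of maximal orbit type: it is an isotropy group, and every isotropy
group contains a conjugate of it. -/
def IsPrincipalIsotropy (X : Type*) [MulAction Γ X] (K : Subgroup Γ) : Prop :=
  (∃ x : X, MulAction.stabilizer Γ x = K) ∧
    ∀ y : X, ∃ g : Γ, conj g K ≤ MulAction.stabilizer Γ y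

/-- `K` is the isotropy group of a singular orbit, i.e. of an orbit whose dimension is smaller than
that of the principal orbits. Isotropy groups being compact Lie groups, `dim K > dim H` for a
principal isotropy group `H ≤ K` means that `H` has infinite index in `K` (`relIndex` is `0` exactly
for infinite index). -/
def IsSingularIsotropy (X : Type*) [MulAction Γ X] (K : Subgroup Γ) : Prop :=
  (∃ x : X, MulAction.stabilizer Γ x = K) ∧
    ∃ H : Subgroup Γ, IsPrincipalIsotropy X H ∧ H ≤ K ∧ H.relIndex K = 0

/-- A torus: a compact connected abelian subgroup. -/
def IsTorus [TopologicalSpace Γ] (T : Subgroup Γ) : Prop :=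
  IsCompact (T : Set Γ) ∧ IsConnected (T : Set Γ) ∧ ∀ s ∈ T, ∀ t ∈ T, s * t = t * s

def IsMaximalTorus [TopologicalSpace Γ] (T : Subgroup Γ) : Prop :=
  Maximal IsTorus T

end Isotropy

/-! ## The subgroups of `SU(2) × SU(2)` in the group diagram -/

/-- The subgroup `{((± id) ^ (p + 1), (± id) ^ p)}`, with the same sign in both entries. -/
def Hgroup (p : ℤ) : Subgroup G where
  carrier := {h | ∃ ε : SU2, (ε.1 = 1 ∨ ε.1 = -1) ∧ h = (ε ^ (p + 1), ε ^ p)}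
  one_mem' := ⟨1, Or.inl rfl, by rw [one_zpow, one_zpow]; rfl⟩
  mul_mem' := by
    rintro _ _ ⟨ε, hε, rfl⟩ ⟨δ, hδ, rfl⟩
    have hc : Commute ε δ := by
      apply Subtype.ext
      rcases hε with h | h <;> simp [h]
    refine ⟨ε * δ, ?_, ?_⟩
    · rcases hε with h | h <;> rcases hδ with k | k <;> simp [h, k]
    · rw [hc.mul_zpow, hc.mul_zpow, Prod.mk_mul_mk]
  inv_mem' := by
    rintro _ ⟨ε, hε, rfl⟩
    refine ⟨ε⁻¹, ?_, Prod.ext (inv_zpow ε (p + 1)).symm (inv_zpow ε p).symm⟩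
    have : (ε⁻¹).1 = star ε.1 := rfl
    rcases hε with h | h <;> simp [this, h]

/-- The diagonal subgroup `Δ SU(2)`. -/
def diagonalSU2 : Subgroup G := ((MonoidHom.id SU2).prod (MonoidHom.id SU2)).range

/-- `K⁻ = Δ SU(2) · H`. -/
def Kminus (p : ℤ) : Subgroup G := diagonalSU2 ⊔ Hgroup p

theorem torusMatrix_mem (z : Circle) :
    Matrix.diagonal ![(z : ℂ), ((z⁻¹ : Circle) : ℂ)] ∈ Matrix.specialUnitaryGroup (Fin 2) ℂ := by
  refine Matrix.mem_specialUnitaryGroup_iff.2 ⟨?_, ?_⟩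
  · rw [Matrix.mem_unitaryGroup_iff]
    ext i j
    have h := Circle.coe_ne_zero z
    fin_cases i <;> fin_cases j <;>
      simp [Matrix.mul_apply, Matrix.star_apply, Matrix.diagonal, ← Circle.coe_inv_eq_conj, h]
  · simp [Matrix.det_diagonal, Fin.prod_univ_two]

/-- The homomorphism `z ↦ diag(z, z⁻¹)` onto the diagonal torus of `SU(2)`. -/
def torusHom : Circle →* SU2 where
  toFun z := ⟨Matrix.diagonal ![(z : ℂ), ((z⁻¹ : Circle) : ℂ)], torusMatrix_mem z⟩
  map_one' := by
    apply Subtype.ext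
    ext i j; fin_cases i <;> fin_cases j <;> simp
  map_mul' z w := by
    apply Subtype.ext
    ext i j; fin_cases i <;> fin_cases j <;> simp [mul_comm]

/-- The subgroup of pairs of diagonal matrices in `SU(2) × SU(2)`. -/
def standardTorus : Subgroup G := (torusHom.prodMap torusHom).range

/-- The homomorphism `z ↦ (diag(z ^ k, z ^ (-k)), diag(z ^ l, z ^ (-l)))`. -/
def slopeHom (k l : ℤ) : Circle →* G where
  toFun z := (torusHom (z ^ k), torusHom (z ^ l))
  map_one' := by simp
  map_mul' z w := by simp [mul_zpow]

/-- `K⁺ = S¹_{(p+1,p)}`, the circle of slope `(p + 1, p)`. -/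
def Kplus (p : ℤ) : Subgroup G := (slopeHom (p + 1) p).range

/-! ## The metrics on `E_p` -/

/-- The Lie algebra `su(3)` of trace free skew Hermitian matrices. -/
def su3 : Submodule ℝ (Matrix (Fin 3) (Fin 3) ℂ) where
  carrier := {X | star X = -X ∧ X.trace = 0}
  zero_mem' := by simp
  add_mem' := by
    rintro X Y ⟨h1, h2⟩ ⟨k1, k2⟩
    exact ⟨by rw [star_add, h1, k1, neg_add], by rw [Matrix.trace_add, h2, k2, add_zero]⟩
  smul_mem' := by
    rintro r X ⟨h1, h2⟩
    exact ⟨by rw [star_smul, h1, smul_neg, star_trivial], by rw [Matrix.trace_smul, h2, smul_zero]⟩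

/-- The adjoint action `X ↦ k X k⁻¹` of `SU(3)` on `su(3)`. -/
def Ad (k : SU3) (X : su3) : su3 :=
  ⟨k.1 * X.1 * star k.1, by
    obtain ⟨h1, h2⟩ := X.2
    have hk : star k.1 * k.1 = 1 :=
      Matrix.mem_unitaryGroup_iff'.1 (Matrix.mem_specialUnitaryGroup_iff.1 k.2).1
    refine ⟨?_, ?_⟩
    · rw [star_mul, star_mul, star_star, h1]; simp [mul_assoc]
    · rw [Matrix.trace_mul_comm, ← mul_assoc, hk, one_mul, h2]⟩

/-- `k` lies in the block subgroup `K = S(U(2) U(1)) ≅ U(2)` of `SU(3)`. -/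
def MemK (k : SU3) : Prop := k.1 0 2 = 0 ∧ k.1 1 2 = 0 ∧ k.1 2 0 = 0 ∧ k.1 2 1 = 0

/-- An `Ad(K)`-invariant inner product on `su(3)`, i.e. a left invariant, `Ad(K)`-invariant
Riemannian metric on `SU(3)`. -/
structure InvariantMetric where
  form : LinearMap.BilinForm ℝ su3
  symm : ∀ X Y, form X Y = form Y X
  pos : ∀ X, X ≠ 0 → 0 < form X X
  invariant : ∀ k, MemK k → ∀ X Y, form (Ad k X) (Ad k Y) = form X Y

/-- `γ : [0, 1] → SU(3)` is a `C¹` curve with `γ' = γ X`, where `X : [0, 1] → su(3)` is the left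
translate of its velocity to the identity. -/
def IsC1Curve (γ : ℝ → SU3) (X : ℝ → su3) : Prop :=
  ContinuousOn X (Set.Icc 0 1) ∧
    ∀ t ∈ Set.Icc (0 : ℝ) 1, ∀ i j,
      HasDerivWithinAt (fun s => (γ s).1 i j) (((γ t).1 * (X t).1) i j) (Set.Icc 0 1) t

/-- The length of a curve whose left translated velocity is `X`. -/
def curveLength (Q : InvariantMetric) (X : ℝ → su3) : ℝ :=
  ∫ t in (0 : ℝ)..1, √(Q.form (X t) (X t))

/-- The distance on `E_p` of the metric for which `SU(3) → E_p` is a Riemannian submersion: the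
infimum of the lengths of curves in `SU(3)` from the fibre over `x` to the fibre over `y`. -/
def quotientEDist (Q : InvariantMetric) {p : ℤ} (x y : E p) : ℝ≥0∞ :=
  ⨅ (γ : ℝ → SU3) (X : ℝ → su3) (_ : IsC1Curve γ X) (_ : proj p (γ 0) = x)
    (_ : proj p (γ 1) = y), ENNReal.ofReal (curveLength Q X)

/-- `c : [0, L] → E_p` is a minimal geodesic, parametrized by arc length, between the orbits
of its end points: it is distance realizing, and no curve between these orbits is shorter. -/
def IsMinimalGeodesicBetweenOrbits (Q : InvariantMetric) {p : ℤ} (L : ℝ) (c : ℝ → E p) : Prop :=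
  (∀ s ∈ Set.Icc 0 L, ∀ t ∈ Set.Icc 0 L, quotientEDist Q (c s) (c t) = ENNReal.ofReal |s - t|) ∧
    ∀ x ∈ MulAction.orbit G (c 0), ∀ y ∈ MulAction.orbit G (c L),
      ENNReal.ofReal L ≤ quotientEDist Q x y

/-- The orbit space `E_p / G`, with the quotient topology. -/
abbrev OrbitSpace (p : ℤ) : Type := MulAction.orbitRel.Quotient G (E p)

/-- The point of `E_p / G` given by the orbit of `x`. -/
def orbitClass {p : ℤ} (x : E p) : OrbitSpace p := Quotient.mk (MulAction.orbitRel G (E p)) x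

end

end CohomOne

open CohomOne

/-!
The action of `SU(2) × SU(2)` on `E_p` and the circle action both preserve the modulus of the corner
entry `A₃₃` of a matrix in `SU(3)`, and `|A₃₃| ∈ [0, 1]` is a complete invariant of the orbits:
the circle makes `A₃₃` real and nonnegative, the second factor `SU(2)` turns the last row into that
of a rotation `rot θ` in the plane of the last two coordinates with `cos θ = |A₃₃|`, and two
matrices in `SU(3)` with the same last row differ by the first factor (`exists_smul_proj_rot`).
So the curve `θ ↦ [rot θ]`, `0 ≤ θ ≤ π / 2`, meets every orbit exactly once.

The isotropy group at `[rot θ]` is found by comparing entries in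
`diag(z, z, z ^ p) · rot θ · diag(1, 1, z ^ (p + 2))⁻¹ = diag(g₁, 1) · rot θ · diag(g₂, 1)⁻¹`. If
`sin θ ≠ 0`, the last row and column express `g₁` and `g₂` by `z`, which gives the points of `K⁺`;
if moreover `cos θ ≠ 0`, the corner entry forces `z ^ 2 = 1`, which leaves `H`. For `θ = 0` the
equation says `z ^ 2 = 1` and `g₁ = z g₂`, which is `K⁻`. As `H` is central and finite, and `K⁻`
and `K⁺` are infinite, the statements on principal and singular isotropy groups follow.

For the metric, the element `diag(-1, -1, 1)` of `K` makes the Lie algebra of `K` orthogonal to its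
complement `ℂ²`, and transitivity of `SU(2)` on spheres makes the metric on `ℂ²` a multiple
`v²` of the standard one (`InvariantMetric.form_hor_le`, `InvariantMetric.form_hor_self`). Along a
curve `γ` with `γ' = γ X`, only the `ℂ²`-part of `X` changes `|A₃₃|`, and the Cauchy-Schwarz
inequality bounds the derivative of the angle `arccos |A₃₃|` by the norm of that part. So `v` times
the change of the angle is at most the length of `γ` (`abs_arccos_sub_le_curveLength`), with
equality for `rot`. Hence `t ↦ [rot (t / v)]` on `[0, v π / 2]` is the required geodesic, and
`v · arccos |A₃₃|` is the continuous inverse of its projection to the orbit space.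
-/

namespace CohomOne

noncomputable section

/-! ### Matrices in `SU(2)` and `SU(3)` -/

theorem SU2.mul_star (g : SU2) : g.1 * star g.1 = 1 :=
  Matrix.mem_unitaryGroup_iff.1 (Matrix.mem_specialUnitaryGroup_iff.1 g.2).1

theorem SU3.mul_star (A : SU3) : A.1 * star A.1 = 1 :=
  Matrix.mem_unitaryGroup_iff.1 (Matrix.mem_specialUnitaryGroup_iff.1 A.2).1

theorem SU3.star_mul (A : SU3) : star A.1 * A.1 = 1 :=
  Matrix.mem_unitaryGroup_iff'.1 (Matrix.mem_specialUnitaryGroup_iff.1 A.2).1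

theorem SU2.det_eq (g : SU2) : g.1 0 0 * g.1 1 1 - g.1 0 1 * g.1 1 0 = 1 := by
  rw [← Matrix.det_fin_two]; exact (Matrix.mem_specialUnitaryGroup_iff.1 g.2).2

/-- The last row of a matrix in `SU(3)` is a unit vector. -/
theorem SU3.normSq_last_row (A : SU3) :
    Complex.normSq (A.1 2 0) + Complex.normSq (A.1 2 1) + Complex.normSq (A.1 2 2) = 1 := by
  have h := congrFun (congrFun (SU3.mul_star A) 2) 2
  simp only [Matrix.mul_apply, Fin.sum_univ_three, Matrix.star_apply, Matrix.one_apply_eq,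
    RCLike.star_def, Complex.mul_conj] at h
  exact_mod_cast h

theorem SU3.normSq_last_col (A : SU3) :
    Complex.normSq (A.1 0 2) + Complex.normSq (A.1 1 2) + Complex.normSq (A.1 2 2) = 1 := by
  have h := congrFun (congrFun (SU3.star_mul A) 2) 2
  simp only [Matrix.mul_apply, Fin.sum_univ_three, Matrix.star_apply, Matrix.one_apply_eq,
    RCLike.star_def, mul_comm (starRingEnd ℂ _), Complex.mul_conj] at h
  exact_mod_cast h

/-- A unit vector of `ℂ²` is the last row of a matrix in `SU(2)`. -/
theorem exists_SU2_last_row_of_unit (u v : ℂ) (h : Complex.normSq u + Complex.normSq v = 1) :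
    ∃ g : SU2, g.1 1 0 = u ∧ g.1 1 1 = v := by
  have h' : u * star u + v * star v = 1 := by
    simp only [RCLike.star_def, Complex.mul_conj]; exact_mod_cast h
  refine ⟨⟨!![star v, -star u; u, v], Matrix.mem_specialUnitaryGroup_iff.2 ⟨?_, ?_⟩⟩, rfl, rfl⟩
  · rw [Matrix.mem_unitaryGroup_iff]
    ext i j
    fin_cases i <;> fin_cases j <;>
      simp [Matrix.mul_apply, Fin.sum_univ_two, Matrix.star_apply] <;>
      simp only [RCLike.star_def] at h' <;> first | linear_combination h' | ring
  · simp only [Matrix.det_fin_two_of]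
    linear_combination h'

/-- Every vector of `ℂ²` of length `r` is `r` times the last row of a matrix in `SU(2)`. -/
theorem exists_SU2_last_row (u v : ℂ) (r : ℝ)
    (h : Complex.normSq u + Complex.normSq v = r ^ 2) :
    ∃ g : SU2, u = r * g.1 1 0 ∧ v = r * g.1 1 1 := by
  rcases eq_or_ne r 0 with rfl | hr
  · have hu := Complex.normSq_nonneg u
    have hv := Complex.normSq_nonneg v
    have hu0 : Complex.normSq u = 0 := by nlinarith
    have hv0 : Complex.normSq v = 0 := by nlinarith
    exact ⟨1, by simpa using hu0, by simpa using hv0⟩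
  · have hr' : (r : ℂ) ≠ 0 := by exact_mod_cast hr
    obtain ⟨g, h1, h2⟩ := exists_SU2_last_row_of_unit (u / r) (v / r) (by
      rw [map_div₀, map_div₀, Complex.normSq_ofReal, ← add_div, h]
      field_simp)
    refine ⟨g, ?_, ?_⟩
    · rw [h1]; field_simp
    · rw [h2]; field_simp

theorem SU2.inv_coe (g : SU2) : (g⁻¹).1 = star g.1 := rfl

/-- A matrix in `SU(2)` with last row `(0, z⁻¹)` is `diag(z, z⁻¹)`. -/
theorem eq_torusHom_of_last_row (g : SU2) (z : Circle) (h0 : g.1 1 0 = 0)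
    (h1 : g.1 1 1 = ((z⁻¹ : Circle) : ℂ)) : g = torusHom z := by
  have hz := Circle.coe_ne_zero z
  have hd := SU2.det_eq g
  have hu := congrFun (congrFun (SU2.mul_star g) 0) 1
  simp only [Matrix.mul_apply, Fin.sum_univ_two, Matrix.star_apply, h0, h1, star_zero, mul_zero,
    zero_add, Matrix.one_apply, zero_ne_one, if_false, sub_zero, Circle.coe_inv,
    Fin.isValue] at hd hu
  have h01 : g.1 0 1 = 0 := by
    rcases mul_eq_zero.1 hu with h | h
    · exact h
    · simp at h
  have h00 : g.1 0 0 = z := by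
    field_simp at hd; exact hd
  apply Subtype.ext
  ext i j
  fin_cases i <;> fin_cases j <;> simp [torusHom, h0, h1, h00, h01]

/-- A matrix in `SU(2)` with last column `(0, z⁻¹)` is `diag(z, z⁻¹)`. -/
theorem eq_torusHom_of_last_col (g : SU2) (z : Circle) (h0 : g.1 0 1 = 0)
    (h1 : g.1 1 1 = ((z⁻¹ : Circle) : ℂ)) : g = torusHom z := by
  have h := eq_torusHom_of_last_row g⁻¹ z⁻¹ (by simp [SU2.inv_coe, Matrix.star_apply, h0])
    (by simp [SU2.inv_coe, Matrix.star_apply, h1, ← Circle.coe_inv_eq_conj])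
  rw [map_inv] at h
  exact inv_injective h

theorem torusHom_injective : Function.Injective torusHom := by
  intro z w h
  have := congrFun (congrFun (congrArg Subtype.val h) 0) 0
  exact Circle.ext (by simpa [torusHom] using this)

/-- A matrix in `SU(3)` with last row `(0, 0, 1)` lies in the block subgroup `SU(2)`. -/
theorem exists_eq_block (B : SU3) (h0 : B.1 2 0 = 0) (h1 : B.1 2 1 = 0) (h2 : B.1 2 2 = 1) :
    ∃ g : SU2, B = block g := by
  have hc := SU3.normSq_last_col B
  rw [h2, map_one] at hc
  have n0 := Complex.normSq_nonneg (B.1 0 2)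
  have n1 := Complex.normSq_nonneg (B.1 1 2)
  have k0 : B.1 0 2 = 0 := Complex.normSq_eq_zero.1 (by linarith)
  have k1 : B.1 1 2 = 0 := Complex.normSq_eq_zero.1 (by linarith)
  have hb : B.1 = blockMatrix !![B.1 0 0, B.1 0 1; B.1 1 0, B.1 1 1] := by
    ext i j
    fin_cases i <;> fin_cases j <;> simp [blockMatrix, h0, h1, h2, k0, k1]
  have hm := SU3.mul_star B
  have hd := (Matrix.mem_specialUnitaryGroup_iff.1 B.2).2
  rw [hb, ← blockMatrix_star, ← blockMatrix_mul, ← blockMatrix_one] at hm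
  rw [hb, blockMatrix_det] at hd
  refine ⟨⟨_, Matrix.mem_specialUnitaryGroup_iff.2
    ⟨Matrix.mem_unitaryGroup_iff.2 ?_, hd⟩⟩, Subtype.ext hb⟩
  ext i j
  have e := fun a b => congrFun (congrFun hm a) b
  have e00 := e 0 0
  have e01 := e 0 1
  have e10 := e 1 0
  have e11 := e 1 1
  fin_cases i <;> fin_cases j
  · exact e00
  · exact e01
  · exact e10
  · exact e11

/-! ### A curve meeting all orbits -/

theorem rotMatrix_mem (θ : ℝ) :
    (!![1, 0, 0; 0, (Real.cos θ : ℂ), -(Real.sin θ : ℂ); 0, (Real.sin θ : ℂ), (Real.cos θ : ℂ)] :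
      Matrix (Fin 3) (Fin 3) ℂ) ∈ Matrix.specialUnitaryGroup (Fin 3) ℂ := by
  have h : (Real.cos θ : ℂ) * Real.cos θ + Real.sin θ * Real.sin θ = 1 := by
    have := Real.cos_sq_add_sin_sq θ
    exact_mod_cast (by nlinarith : Real.cos θ * Real.cos θ + Real.sin θ * Real.sin θ = 1)
  refine Matrix.mem_specialUnitaryGroup_iff.2 ⟨?_, ?_⟩
  · rw [Matrix.mem_unitaryGroup_iff]
    ext i j
    fin_cases i <;> fin_cases j <;>
      simp [Matrix.mul_apply, Fin.sum_univ_three, Matrix.star_apply, -Complex.ofReal_cos,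
        -Complex.ofReal_sin] <;>
      first | linear_combination h | ring
  · simp [Matrix.det_fin_three, -Complex.ofReal_cos, -Complex.ofReal_sin]
    linear_combination h

/-- The rotation by the angle `θ` in the plane of the last two coordinates. Its projection to `E_p`
is, up to the speed, the geodesic that is perpendicular to all orbits. -/
def rot (θ : ℝ) : SU3 := ⟨_, rotMatrix_mem θ⟩

theorem continuous_rot : Continuous rot := by
  refine Continuous.subtype_mk (continuous_matrix fun i j => ?_) _
  fin_cases i <;> fin_cases j <;>
    simp [-Complex.ofReal_cos, -Complex.ofReal_sin] <;> fun_prop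

theorem rot_zero : rot 0 = 1 := by
  apply Subtype.ext
  ext i j
  fin_cases i <;> fin_cases j <;> simp [rot]

theorem proj_eq_iff (p : ℤ) (A B : SU3) : proj p A = proj p B ↔
    ∃ z : Circle, B.1 = circleDiag ![1, 1, p] z * A.1 * circleDiag ![0, 0, p + 2] z⁻¹ :=
  Quotient.eq (r := eschenburgSetoid ![1, 1, p] ![0, 0, p + 2])

theorem smul_proj (p : ℤ) (g : G) (A : SU3) :
    g • proj p A = proj p (block g.1 * A * (block g.2)⁻¹) := rfl

theorem proj_surjective (p : ℤ) : Function.Surjective (proj p) := Quotient.mk_surjective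

theorem continuous_proj (p : ℤ) : Continuous (proj p) := continuous_quotient_mk'

/-- Every point of the circle is a square. -/
theorem Circle.exists_sq_eq (w : Circle) : ∃ z : Circle, z ^ 2 = w := by
  refine ⟨Circle.exp (Complex.arg w / 2), ?_⟩
  rw [sq, ← Circle.exp_add, add_halves, Circle.exp_arg]

/-- The circle acts on the corner entry `A₃₃` by `z⁻²`, hence can make it real and nonnegative. -/
theorem exists_circle_mul_eq_norm (d : ℂ) : ∃ z : Circle, ((z : ℂ) ^ 2)⁻¹ * d = (‖d‖ : ℂ) := by
  obtain ⟨z, hz⟩ := Circle.exists_sq_eq (Circle.exp d.arg)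
  refine ⟨z, ?_⟩
  have hz' : (z : ℂ) ^ 2 = Complex.exp (d.arg * Complex.I) := by
    have := congrArg (fun w : Circle => (w : ℂ)) hz
    simpa using this
  rw [hz']
  nth_rewrite 2 [← Complex.norm_mul_exp_arg_mul_I d]
  have := Complex.exp_ne_zero (d.arg * Complex.I)
  field_simp

/-- The matrix `diag(z, z, z ^ p) A diag(1, 1, z ^ (p + 2))⁻¹` lies in `SU(3)`. -/
theorem circle_smul_mem (p : ℤ) (z : Circle) (A : SU3) :
    circleDiag ![1, 1, p] z * A.1 * circleDiag ![0, 0, p + 2] z⁻¹ ∈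
      Matrix.specialUnitaryGroup (Fin 3) ℂ := by
  have hu : ∀ (a : Fin 3 → ℤ) (w : Circle), circleDiag a w ∈ Matrix.unitaryGroup (Fin 3) ℂ := by
    intro a w
    rw [Matrix.mem_unitaryGroup_iff, circleDiag, Matrix.star_eq_conjTranspose,
      Matrix.diagonal_conjTranspose, Matrix.diagonal_mul_diagonal, ← Matrix.diagonal_one]
    congr 1
    funext i
    simp only [Pi.star_apply, RCLike.star_def, ← Circle.coe_inv_eq_conj, ← Circle.coe_mul]
    simp
  have hz := Circle.coe_ne_zero z
  refine Matrix.mem_specialUnitaryGroup_iff.2 ⟨mul_mem (mul_mem (hu _ _)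
    (Matrix.mem_specialUnitaryGroup_iff.1 A.2).1) (hu _ _), ?_⟩
  rw [Matrix.det_mul, Matrix.det_mul, (Matrix.mem_specialUnitaryGroup_iff.1 A.2).2, circleDiag,
    circleDiag, Matrix.det_diagonal, Matrix.det_diagonal]
  simp only [Fin.prod_univ_three, mul_one, ← Circle.coe_mul]
  rw [← Circle.coe_one]
  refine congrArg _ ?_
  simp only [Matrix.cons_val, zpow_one, zpow_zero, one_mul, inv_zpow]
  rw [zpow_add, mul_inv]
  norm_cast
  group

theorem block_coe (g : SU2) : (block g).1 = blockMatrix g.1 := rfl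

/-- Every `G`-orbit in `E_p` meets the curve `θ ↦ [rot θ]`, at the angle `arccos |A₃₃|`. -/
theorem exists_smul_proj_rot (p : ℤ) (A : SU3) :
    ∃ g : G, proj p A = g • proj p (rot (Real.arccos ‖A.1 2 2‖)) := by
  -- move along the circle to make the corner entry real and nonnegative
  obtain ⟨z, hz⟩ := exists_circle_mul_eq_norm (A.1 2 2)
  set B : SU3 := ⟨_, circle_smul_mem p z A⟩ with hB
  have hAB : proj p A = proj p B := (proj_eq_iff p A B).2 ⟨z, rfl⟩
  have hzne := Circle.coe_ne_zero z
  have hB22 : B.1 2 2 = (‖A.1 2 2‖ : ℂ) := by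
    rw [← hz]
    simp [hB, circleDiag, Matrix.mul_diagonal, Matrix.diagonal_mul]
    rw [zpow_add₀ hzne]
    field_simp
  set θ := Real.arccos ‖A.1 2 2‖ with hθ
  have hn : ‖A.1 2 2‖ ≤ 1 := by
    have h := SU3.normSq_last_row A
    rw [Complex.normSq_eq_norm_sq (A.1 2 2)] at h
    have := Complex.normSq_nonneg (A.1 2 0)
    have := Complex.normSq_nonneg (A.1 2 1)
    nlinarith [norm_nonneg (A.1 2 2)]
  have hcos : Real.cos θ = ‖A.1 2 2‖ :=
    Real.cos_arccos (by linarith [norm_nonneg (A.1 2 2)]) hn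
  have hrow := SU3.normSq_last_row B
  rw [hB22, ← hcos, Complex.normSq_ofReal] at hrow
  obtain ⟨g₂, e0, e1⟩ := exists_SU2_last_row (B.1 2 0) (B.1 2 1) (Real.sin θ)
    (by nlinarith [Real.cos_sq_add_sin_sq θ])
  -- `rot θ * block g₂` has the same last row as `B`
  have hs : (Real.cos θ : ℂ) * Real.cos θ + Real.sin θ * Real.sin θ = 1 := by
    have := Real.cos_sq_add_sin_sq θ
    exact_mod_cast (by nlinarith : Real.cos θ * Real.cos θ + Real.sin θ * Real.sin θ = 1)
  have hrow2 : ∀ j, B.1 2 j = (rot θ * block g₂).1 2 j := by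
    intro j
    fin_cases j
    · simpa [rot, block_coe, blockMatrix, Matrix.mul_apply, Fin.sum_univ_three] using e0
    · simpa [rot, block_coe, blockMatrix, Matrix.mul_apply, Fin.sum_univ_three] using e1
    · simpa [rot, block_coe, blockMatrix, Matrix.mul_apply, Fin.sum_univ_three, hcos] using hB22
  have hone : ∀ j, (B * (rot θ * block g₂)⁻¹).1 2 j = (1 : SU3).1 2 j := by
    intro j
    rw [← mul_inv_cancel (rot θ * block g₂)]
    simp only [Submonoid.coe_mul, Matrix.mul_apply (M := B.1), hrow2]
    simp only [Matrix.mul_apply]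
  obtain ⟨g₁, hg₁⟩ := exists_eq_block (B * (rot θ * block g₂)⁻¹) (by rw [hone]; simp)
    (by rw [hone]; simp) (by rw [hone]; simp)
  refine ⟨(g₁, g₂⁻¹), ?_⟩
  rw [hAB, smul_proj]
  congr 1
  rw [map_inv, inv_inv, mul_assoc]
  exact mul_inv_eq_iff_eq_mul.1 hg₁

/-! ### The group `H` -/

theorem Circle.coe_eq_one_or_neg_one {z : Circle} (hz : z ^ 2 = 1) :
    (z : ℂ) = 1 ∨ (z : ℂ) = -1 := by
  rw [← _root_.sq_eq_sq_iff_eq_or_eq_neg, one_pow]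
  exact_mod_cast congrArg (fun w : Circle => (w : ℂ)) hz

theorem torusHom_coe_eq_one_or_neg_one {z : Circle} (hz : z ^ 2 = 1) :
    (torusHom z).1 = 1 ∨ (torusHom z).1 = -1 := by
  rcases Circle.coe_eq_one_or_neg_one hz with h | h
  · left
    ext i j; fin_cases i <;> fin_cases j <;> simp [torusHom, Circle.coe_inv, h]
  · right
    ext i j; fin_cases i <;> fin_cases j <;> simp [torusHom, Circle.coe_inv, h]

/-- The point `-1` of the circle. -/
def negOne : Circle := Circle.exp Real.pi

theorem negOne_coe : (negOne : ℂ) = -1 := by simp [negOne]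

theorem negOne_sq : negOne ^ 2 = 1 := Circle.ext (by simp [negOne_coe])

theorem negOne_ne_one : negOne ≠ 1 := by
  intro h
  have := congrArg (fun w : Circle => (w : ℂ)) h
  simp only [negOne_coe, Circle.coe_one] at this
  norm_num at this

/-- `H` consists of the images of `1` and `-1` under the parametrization of `K⁺`. -/
theorem mem_Hgroup_iff (p : ℤ) (h : G) :
    h ∈ Hgroup p ↔ ∃ z : Circle, z ^ 2 = 1 ∧ h = slopeHom (p + 1) p z := by
  have key : ∀ z : Circle, slopeHom (p + 1) p z = (torusHom z ^ (p + 1), torusHom z ^ p) := by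
    intro z; rw [← map_zpow, ← map_zpow]; rfl
  constructor
  · rintro ⟨ε, hε, rfl⟩
    rcases hε with h | h
    · refine ⟨1, one_pow 2, ?_⟩
      have : ε = torusHom 1 := by rw [map_one]; exact Subtype.ext h
      rw [key, this]
    · refine ⟨negOne, negOne_sq, ?_⟩
      have : ε = torusHom negOne := by
        apply Subtype.ext
        rw [h]
        ext i j; fin_cases i <;> fin_cases j <;> simp [torusHom, negOne_coe]
      rw [key, this]
  · rintro ⟨z, hz, rfl⟩
    exact ⟨torusHom z, torusHom_coe_eq_one_or_neg_one hz, key z⟩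

theorem slopeHom_injective (p : ℤ) : Function.Injective (slopeHom (p + 1) p) := by
  intro z w h
  have h1 := torusHom_injective (congrArg Prod.fst h)
  have h2 := torusHom_injective (congrArg Prod.snd h)
  rw [zpow_add, zpow_add, h2, zpow_one, zpow_one] at h1
  exact mul_left_cancel h1

theorem card_Hgroup (p : ℤ) : Nat.card (Hgroup p) = 2 := by
  rw [Nat.card_eq_two_iff]
  refine ⟨1, ⟨slopeHom (p + 1) p negOne, (mem_Hgroup_iff p _).2 ⟨_, negOne_sq, rfl⟩⟩, ?_, ?_⟩
  · intro h
    have h' := congrArg Subtype.val h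
    exact negOne_ne_one (slopeHom_injective p (by rw [map_one]; exact h'.symm))
  · rw [Set.eq_univ_iff_forall]
    rintro ⟨x, hx⟩
    obtain ⟨z, hz, rfl⟩ := (mem_Hgroup_iff p x).1 hx
    rcases Circle.coe_eq_one_or_neg_one hz with h | h
    · left
      have : z = 1 := Circle.ext (by simpa using h)
      exact Subtype.ext (by simp [this])
    · right
      have : z = negOne := Circle.ext (by rw [h, negOne_coe])
      exact Subtype.ext (by simp [this])

theorem Hgroup_mulEquiv (p : ℤ) : Nonempty (Hgroup p ≃* Multiplicative (ZMod 2)) :=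
  ⟨mulEquivOfPrimeCardEq (p := 2) (card_Hgroup p) (by simp)⟩

theorem commute_of_coe_eq_one_or_neg_one {ε : SU2} (h : ε.1 = 1 ∨ ε.1 = -1) (g : SU2) :
    Commute g ε := by
  apply Subtype.ext
  rcases h with h | h <;> simp [h]

/-- `H` is a central subgroup. -/
theorem mul_comm_of_mem_Hgroup {p : ℤ} {h : G} (hh : h ∈ Hgroup p) (g : G) : g * h = h * g := by
  obtain ⟨ε, hε, rfl⟩ := hh
  exact Prod.ext ((commute_of_coe_eq_one_or_neg_one hε g.1).zpow_right (p + 1))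
    ((commute_of_coe_eq_one_or_neg_one hε g.2).zpow_right p)

theorem conj_Hgroup (p : ℤ) (g : G) : conj g (Hgroup p) = Hgroup p := by
  ext x
  rw [conj, Subgroup.mem_map_equiv, MulAut.conj_symm_apply]
  constructor
  · intro h
    have := mul_comm_of_mem_Hgroup h g
    rw [← mul_assoc, ← mul_assoc, mul_inv_cancel, one_mul] at this
    have h2 : x = g⁻¹ * x * g := mul_right_cancel this
    rwa [h2]
  · intro h
    rwa [mul_assoc, ← mul_comm_of_mem_Hgroup h, inv_mul_cancel_left]

/-! ### Isotropy groups -/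

theorem mem_stabilizer_proj_iff (p : ℤ) (g : G) (A : SU3) :
    g ∈ MulAction.stabilizer G (proj p A) ↔ ∃ z : Circle,
      circleDiag ![1, 1, p] z * A.1 * circleDiag ![0, 0, p + 2] z⁻¹ =
        blockMatrix g.1.1 * A.1 * blockMatrix (star g.2.1) := by
  rw [MulAction.mem_stabilizer_iff, smul_proj, eq_comm, proj_eq_iff, ← map_inv]
  simp only [Submonoid.coe_mul, block_coe, SU2.inv_coe]
  exact exists_congr fun _ => eq_comm

/-- `H` is contained in the ineffective kernel of the action. -/
theorem Hgroup_le_stabilizer (p : ℤ) (x : E p) : Hgroup p ≤ MulAction.stabilizer G x := by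
  obtain ⟨A, rfl⟩ := proj_surjective p x
  intro h hh
  obtain ⟨z, hz, rfl⟩ := (mem_Hgroup_iff p h).1 hh
  refine (mem_stabilizer_proj_iff p _ A).2 ⟨z, ?_⟩
  have hne := Circle.coe_ne_zero z
  rcases Circle.coe_eq_one_or_neg_one hz with h | h
  · ext i j
    fin_cases i <;> fin_cases j <;>
      simp [circleDiag, blockMatrix, slopeHom, torusHom, h, Matrix.mul_apply,
        Fin.sum_univ_three, Matrix.vecMul, dotProduct]
  · rcases Int.even_or_odd p with hp | hp
    all_goals
      have hone : (-1 : ℂ) ≠ 0 := by norm_num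
      ext i j
      fin_cases i <;> fin_cases j <;>
        simp [circleDiag, blockMatrix, slopeHom, torusHom, h, Matrix.mul_apply, Fin.sum_univ_three,
          Matrix.vecMul, dotProduct, zpow_add₀ hone, hp.neg_one_zpow]

/-- An element fixing `[rot θ]` lies in `K⁺` as soon as `sin θ ≠ 0`: the last column and the last
row of the equation `z · rot θ = (g₁, g₂) · rot θ` determine `g₁` and `g₂` in terms of `z`. If also
`cos θ ≠ 0`, the corner entry forces `z ^ 2 = 1`. -/
theorem eq_slopeHom_of_mem_stabilizer_rot {p : ℤ} {θ : ℝ} (hs : Real.sin θ ≠ 0) {g : G}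
    (hg : g ∈ MulAction.stabilizer G (proj p (rot θ))) :
    ∃ z : Circle, g = slopeHom (p + 1) p z ∧ (Real.cos θ ≠ 0 → z ^ 2 = 1) := by
  obtain ⟨z, hz⟩ := (mem_stabilizer_proj_iff p g _).1 hg
  have hne := Circle.coe_ne_zero z
  have hs' : (Real.sin θ : ℂ) ≠ 0 := by exact_mod_cast hs
  have e := fun i j => congrFun (congrFun hz i) j
  have e02 := e 0 2
  have e12 := e 1 2
  have e20 := e 2 0
  have e21 := e 2 1
  have e22 := e 2 2
  simp [circleDiag, blockMatrix, rot, Matrix.mul_apply, Fin.sum_univ_three, Matrix.star_apply,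
    Matrix.diagonal, -Complex.ofReal_cos, -Complex.ofReal_sin, hs] at e02 e12 e20 e21 e22
  have hzp : (z : ℂ) ^ (p + 2) = z ^ p * z ^ 2 := by
    rw [zpow_add₀ hne]; norm_cast
  have hzp0 : (z : ℂ) ^ p ≠ 0 := zpow_ne_zero _ hne
  rw [hzp] at e12 e22
  refine ⟨z, Prod.ext ?_ ?_, ?_⟩
  · refine eq_torusHom_of_last_col g.1 (z ^ (p + 1)) e02 ?_
    rw [Circle.coe_inv, Circle.coe_zpow, zpow_add₀ hne, zpow_one]
    refine mul_right_cancel₀ hs' (e12.symm.trans ?_)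
    field_simp
  · refine eq_torusHom_of_last_col g.2 (z ^ p) e20 ?_
    have h := mul_left_cancel₀ hs' ((mul_comm _ _).trans e21)
    rw [Circle.coe_inv_eq_conj, Circle.coe_zpow, h, Complex.conj_conj]
  · intro hc
    have hc' : (Real.cos θ : ℂ) ≠ 0 := by exact_mod_cast hc
    have h : (z : ℂ) ^ 2 = 1 := by
      field_simp at e22
      exact e22.symm
    exact Circle.ext (by simpa using h)

theorem stabilizer_rot_of_ne {p : ℤ} {θ : ℝ} (hs : Real.sin θ ≠ 0) (hc : Real.cos θ ≠ 0) :
    MulAction.stabilizer G (proj p (rot θ)) = Hgroup p := by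
  refine le_antisymm (fun g hg => ?_) (Hgroup_le_stabilizer p _)
  obtain ⟨z, h, hz⟩ := eq_slopeHom_of_mem_stabilizer_rot hs hg
  exact (mem_Hgroup_iff p g).2 ⟨z, hz hc, h⟩

theorem stabilizer_rot_pi_div_two (p : ℤ) :
    MulAction.stabilizer G (proj p (rot (Real.pi / 2))) = Kplus p := by
  refine le_antisymm (fun g hg => ?_) ?_
  · obtain ⟨z, h, -⟩ := eq_slopeHom_of_mem_stabilizer_rot (by simp) hg
    exact ⟨z, h.symm⟩
  · rintro _ ⟨z, rfl⟩
    refine (mem_stabilizer_proj_iff p _ _).2 ⟨z, ?_⟩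
    have hne := Circle.coe_ne_zero z
    have hzp : (z : ℂ) ^ p ≠ 0 := zpow_ne_zero _ hne
    ext i j
    fin_cases i <;> fin_cases j <;>
      simp [circleDiag, blockMatrix, rot, slopeHom, torusHom, Matrix.mul_apply,
        Fin.sum_univ_three, ← Circle.coe_inv_eq_conj] <;>
      simp only [zpow_add₀ hne, zpow_one] <;> field_simp

/-- `K⁻` consists of the pairs `(± g, g)`, which fix `[1]`. -/
theorem stabilizer_rot_zero (p : ℤ) :
    MulAction.stabilizer G (proj p (rot 0)) = Kminus p := by
  refine le_antisymm (fun g hg => ?_) (sup_le ?_ (Hgroup_le_stabilizer p _))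
  · obtain ⟨z, hz⟩ := (mem_stabilizer_proj_iff p g _).1 hg
    have hne := Circle.coe_ne_zero z
    have e := fun i j => congrFun (congrFun hz i) j
    have e22 := e 2 2
    have e00 := e 0 0
    have e01 := e 0 1
    have e10 := e 1 0
    have e11 := e 1 1
    simp [rot_zero, circleDiag, blockMatrix, Matrix.mul_apply, Fin.sum_univ_three,
      Matrix.diagonal] at e00 e01 e10 e11 e22
    -- the corner entry gives `z ^ 2 = 1`, and the upper left block then gives `g₁ = z g₂`
    have hz2 : z ^ 2 = 1 := by
      rw [zpow_add₀ hne] at e22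
      have hzp : (z : ℂ) ^ p ≠ 0 := zpow_ne_zero _ hne
      field_simp at e22
      refine Circle.ext ?_
      simp only [Circle.coe_pow, Circle.coe_one]
      exact_mod_cast e22.symm
    have ht : g.1 * g.2⁻¹ = torusHom z := by
      have hinv : (z : ℂ)⁻¹ = z := by
        refine inv_eq_of_mul_eq_one_right ?_
        have := congrArg (fun w : Circle => (w : ℂ)) hz2
        simpa [sq] using this
      apply Subtype.ext
      ext i j
      fin_cases i <;> fin_cases j <;>
        simp [torusHom, SU2.inv_coe, Matrix.mul_apply, Matrix.star_apply, hinv, ← e00, ← e01,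
          ← e10, ← e11]
    have hc := commute_of_coe_eq_one_or_neg_one (torusHom_coe_eq_one_or_neg_one hz2) g.2
    have hmul : g = (g.2 * (torusHom (z ^ p))⁻¹, g.2 * (torusHom (z ^ p))⁻¹) *
        slopeHom (p + 1) p z := by
      refine Prod.ext ?_ ?_
      · change g.1 = g.2 * (torusHom (z ^ p))⁻¹ * torusHom (z ^ (p + 1))
        rw [mul_assoc, ← map_inv, ← map_mul, ← zpow_neg, ← zpow_add, neg_add_cancel_left, zpow_one,
          hc.eq, ← ht, inv_mul_cancel_right]
      · change g.2 = g.2 * (torusHom (z ^ p))⁻¹ * torusHom (z ^ p)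
        rw [inv_mul_cancel_right]
    rw [hmul]
    exact mul_mem (Subgroup.mem_sup_left ⟨_, rfl⟩)
      (Subgroup.mem_sup_right ((mem_Hgroup_iff p _).2 ⟨z, hz2, rfl⟩))
  · rintro _ ⟨g, rfl⟩
    refine (mem_stabilizer_proj_iff p _ _).2 ⟨1, ?_⟩
    have h := congrArg blockMatrix (SU2.mul_star g)
    rw [blockMatrix_mul, blockMatrix_one] at h
    simpa [circleDiag_one, rot_zero] using h.symm

/-- Up to conjugation, there are three isotropy groups. -/
theorem stabilizer_eq_conj (p : ℤ) (x : E p) :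
    (∃ g : G, MulAction.stabilizer G x = conj g (Kminus p)) ∨
      (∃ g : G, MulAction.stabilizer G x = conj g (Kplus p)) ∨
        MulAction.stabilizer G x = Hgroup p := by
  obtain ⟨A, rfl⟩ := proj_surjective p x
  obtain ⟨g, hg⟩ := exists_smul_proj_rot p A
  rw [hg, MulAction.stabilizer_smul_eq_stabilizer_map_conj]
  have h0 := Real.arccos_nonneg ‖A.1 2 2‖
  have h1 : Real.arccos ‖A.1 2 2‖ ≤ Real.pi / 2 := Real.arccos_le_pi_div_two.2 (norm_nonneg _)
  rcases h0.eq_or_lt with h | h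
  · left
    exact ⟨g, by rw [← h, stabilizer_rot_zero]; rfl⟩
  right
  rcases h1.eq_or_lt with k | k
  · left
    exact ⟨g, by rw [k, stabilizer_rot_pi_div_two]; rfl⟩
  · right
    rw [stabilizer_rot_of_ne (Real.sin_pos_of_pos_of_lt_pi h (by linarith [Real.pi_pos])).ne'
      (Real.cos_pos_of_mem_Ioo ⟨by linarith [Real.pi_pos], k⟩).ne']
    exact conj_Hgroup p g

theorem conj_mono {Γ : Type*} [Group Γ] (g : Γ) {K L : Subgroup Γ} (h : K ≤ L) :
    conj g K ≤ conj g L := Subgroup.map_mono h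

theorem conj_inv_conj {Γ : Type*} [Group Γ] (g : Γ) (K : Subgroup Γ) :
    conj g⁻¹ (conj g K) = K := by
  ext x
  simp only [conj, Subgroup.mem_map_equiv, MulAut.conj_symm_apply]
  simp [mul_assoc]

theorem exists_stabilizer_eq_Hgroup (p : ℤ) : ∃ x : E p, MulAction.stabilizer G x = Hgroup p :=
  ⟨proj p (rot (Real.pi / 4)), stabilizer_rot_of_ne (by simp) (by simp)⟩

theorem isPrincipalIsotropy_iff (p : ℤ) (K : Subgroup G) :
    IsPrincipalIsotropy (E p) K ↔ K = Hgroup p := by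
  constructor
  · rintro ⟨⟨x, rfl⟩, h⟩
    obtain ⟨y, hy⟩ := exists_stabilizer_eq_Hgroup p
    obtain ⟨g, hg⟩ := h y
    refine le_antisymm ?_ (Hgroup_le_stabilizer p x)
    have := conj_mono g⁻¹ hg
    rwa [conj_inv_conj, hy, conj_Hgroup] at this
  · rintro rfl
    refine ⟨exists_stabilizer_eq_Hgroup p, fun y => ⟨1, ?_⟩⟩
    rw [conj_Hgroup]
    exact Hgroup_le_stabilizer p y

instance : Infinite Circle := by
  have : Nontrivial Circle := ⟨negOne, 1, negOne_ne_one⟩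
  exact Set.infinite_univ_iff.1
    ((isPreconnected_univ (α := Circle)).infinite_of_nontrivial Set.nontrivial_univ)

theorem infinite_Kplus (p : ℤ) : Infinite (Kplus p) :=
  Infinite.of_injective _ (MonoidHom.ofInjective (slopeHom_injective p)).injective

theorem infinite_Kminus (p : ℤ) : Infinite (Kminus p) := by
  refine Infinite.of_injective
    (fun z : Circle => (⟨(torusHom z, torusHom z), Subgroup.mem_sup_left ⟨_, rfl⟩⟩ : Kminus p)) ?_
  intro z w h
  exact torusHom_injective (congrArg (fun x : Kminus p => x.1.1) h)

theorem infinite_conj {Γ : Type*} [Group Γ] (g : Γ) {K : Subgroup Γ} (h : Infinite K) :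
    Infinite (conj g K) :=
  Infinite.of_injective _ (K.equivMapOfInjective _ (MulAut.conj g).injective).injective

/-- As `H` is finite, it has infinite index exactly in the infinite groups. -/
theorem relIndex_Hgroup_eq_zero {p : ℤ} {K : Subgroup G} (h : Hgroup p ≤ K) (hK : Infinite K) :
    (Hgroup p).relIndex K = 0 := by
  have hc := Subgroup.card_mul_index ((Hgroup p).subgroupOf K)
  rw [Nat.card_eq_zero_of_infinite (α := K),
    Nat.card_congr (Subgroup.subgroupOfEquivOfLe h).toEquiv, card_Hgroup] at hc
  exact (mul_eq_zero.1 hc).resolve_left two_ne_zero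

theorem isSingularIsotropy_iff (p : ℤ) (K : Subgroup G) : IsSingularIsotropy (E p) K ↔
    ∃ g : G, K = conj g (Kminus p) ∨ K = conj g (Kplus p) := by
  simp only [IsSingularIsotropy, isPrincipalIsotropy_iff, exists_eq_left]
  constructor
  · rintro ⟨⟨x, rfl⟩, -, h⟩
    rcases stabilizer_eq_conj p x with ⟨g, hg⟩ | ⟨g, hg⟩ | hg
    · exact ⟨g, Or.inl hg⟩
    · exact ⟨g, Or.inr hg⟩
    · rw [hg, Subgroup.relIndex_self] at h
      exact absurd h one_ne_zero
  · have key : ∀ (y : E p) (g : G), Infinite (MulAction.stabilizer G y) →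
        (∃ x : E p, MulAction.stabilizer G x = conj g (MulAction.stabilizer G y)) ∧
          Hgroup p ≤ conj g (MulAction.stabilizer G y) ∧
          (Hgroup p).relIndex (conj g (MulAction.stabilizer G y)) = 0 := by
      intro y g hy
      have hx : MulAction.stabilizer G (g • y) = conj g (MulAction.stabilizer G y) :=
        MulAction.stabilizer_smul_eq_stabilizer_map_conj g y
      have hle := hx ▸ Hgroup_le_stabilizer p (g • y)
      exact ⟨⟨_, hx⟩, hle, relIndex_Hgroup_eq_zero hle (infinite_conj g hy)⟩
    rintro ⟨g, rfl | rfl⟩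
    · rw [← stabilizer_rot_zero]
      exact key _ g (by rw [stabilizer_rot_zero]; exact infinite_Kminus p)
    · rw [← stabilizer_rot_pi_div_two]
      exact key _ g (by rw [stabilizer_rot_pi_div_two]; exact infinite_Kplus p)

/-! ### The maximal torus -/

theorem continuous_torusHom : Continuous torusHom := by
  refine Continuous.subtype_mk (continuous_matrix fun i j => ?_) _
  fin_cases i <;> fin_cases j <;> simp [Circle.coe_inv_eq_conj, -Circle.coe_inv] <;> fun_prop

/-- A matrix in `SU(2)` that commutes with `diag(i, -i)` is diagonal. -/
theorem mem_range_torusHom_of_commute {g : SU2}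
    (h : g * torusHom (Circle.exp (Real.pi / 2)) = torusHom (Circle.exp (Real.pi / 2)) * g) :
    g ∈ torusHom.range := by
  have hI : ((Circle.exp (Real.pi / 2) : Circle) : ℂ) = Complex.I := by
    rw [Circle.coe_exp]
    push_cast
    exact Complex.exp_pi_div_two_mul_I
  have e := fun i j => congrFun (congrFun (congrArg Subtype.val h) i) j
  have e10 := e 1 0
  simp [torusHom, Matrix.mul_apply, hI] at e10
  have h10 : g.1 1 0 = 0 := by
    have : g.1 1 0 * (2 * Complex.I) = 0 := by linear_combination e10
    simpa using this
  have hu := congrFun (congrFun (SU2.mul_star g) 1) 1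
  simp only [Matrix.mul_apply, Fin.sum_univ_two, Matrix.star_apply, h10, Matrix.one_apply_eq,
    RCLike.star_def, Complex.mul_conj, map_zero, Complex.ofReal_zero, zero_add] at hu
  have hn : ‖g.1 1 1‖ = 1 := by
    rw [Complex.normSq_eq_norm_sq] at hu
    have h2 : ‖g.1 1 1‖ ^ 2 = 1 := by exact_mod_cast hu
    exact (pow_eq_one_iff_of_nonneg (norm_nonneg _) two_ne_zero).1 h2
  let w : Circle := ⟨g.1 1 1, mem_sphere_zero_iff_norm.2 hn⟩
  exact ⟨w⁻¹, (eq_torusHom_of_last_row g w⁻¹ h10 (by rw [inv_inv])).symm⟩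

theorem isMaximalTorus_standardTorus : IsMaximalTorus standardTorus := by
  have hc : Continuous (torusHom.prodMap torusHom) :=
    (continuous_torusHom.comp continuous_fst).prodMk (continuous_torusHom.comp continuous_snd)
  refine ⟨⟨?_, ?_, ?_⟩, fun T hT hle => ?_⟩
  · rw [standardTorus, MonoidHom.coe_range]
    exact isCompact_range hc
  · rw [standardTorus, MonoidHom.coe_range]
    exact isConnected_range hc
  · rintro _ ⟨s, rfl⟩ _ ⟨t, rfl⟩
    rw [← map_mul, mul_comm, map_mul]
  · intro g hg
    have h := hT.2.2 g hg _ (hle ⟨(Circle.exp (Real.pi / 2), Circle.exp (Real.pi / 2)), rfl⟩)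
    obtain ⟨z, hz⟩ := mem_range_torusHom_of_commute (congrArg Prod.fst h)
    obtain ⟨w, hw⟩ := mem_range_torusHom_of_commute (congrArg Prod.snd h)
    exact ⟨(z, w), Prod.ext hz hw⟩

theorem Kplus_le_standardTorus (p : ℤ) : Kplus p ≤ standardTorus := by
  rintro _ ⟨z, rfl⟩
  exact ⟨(z ^ (p + 1), z ^ p), rfl⟩

/-! ### Invariant metrics -/

/-- The element of the orthogonal complement of the Lie algebra of `K` with last column
`(x, y, 0)`. -/
def hor (x y : ℂ) : su3 :=
  ⟨!![0, 0, x; 0, 0, y; -star x, -star y, 0], by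
    refine ⟨?_, ?_⟩
    · ext i j
      fin_cases i <;> fin_cases j <;> simp [Matrix.star_apply]
    · simp [Matrix.trace_fin_three]⟩

theorem memK_block (g : SU2) : MemK (block g) := by
  simp [MemK, block_coe, blockMatrix]

theorem Ad_block_coe (g : SU2) (X : su3) :
    (Ad (block g) X).1 = blockMatrix g.1 * X.1 * blockMatrix (star g.1) := by
  rw [blockMatrix_star]; rfl

theorem blockMatrix_torusHom_negOne :
    blockMatrix (torusHom negOne).1 = Matrix.diagonal ![-1, -1, 1] := by
  ext i j
  fin_cases i <;> fin_cases j <;> simp [blockMatrix, torusHom, negOne_coe]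

theorem Ad_block_torusHom_negOne_coe (X : su3) : (Ad (block (torusHom negOne)) X).1 =
    Matrix.diagonal ![-1, -1, 1] * X.1 * Matrix.diagonal ![-1, -1, 1] := by
  rw [Ad_block_coe, blockMatrix_star, blockMatrix_torusHom_negOne, Matrix.star_eq_conjTranspose,
    Matrix.diagonal_conjTranspose]
  congr 2
  funext i
  fin_cases i <;> simp

namespace InvariantMetric

variable (Q : InvariantMetric)

/-- The squared length of the velocity of the rotations `rot`. -/
def speedSq : ℝ := Q.form (hor 0 (-1)) (hor 0 (-1))

theorem speedSq_pos : 0 < Q.speedSq := by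
  refine Q.pos _ fun h => ?_
  have := congrFun (congrFun (congrArg Subtype.val h) 1) 2
  simp [hor] at this

/-- The subgroup `SU(2)` of `K` is transitive on the unit sphere of the complement `ℂ²` of the Lie
algebra of `K`, so an invariant metric is a multiple of the standard one there. -/
theorem form_hor_self (x y : ℂ) :
    Q.form (hor x y) (hor x y) = (Complex.normSq x + Complex.normSq y) * Q.speedSq := by
  set r := √(Complex.normSq x + Complex.normSq y) with hr
  have hr2 : r ^ 2 = Complex.normSq x + Complex.normSq y :=
    Real.sq_sqrt (add_nonneg (Complex.normSq_nonneg x) (Complex.normSq_nonneg y))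
  obtain ⟨h, h1, h2⟩ := exists_SU2_last_row (-star x) (-star y) r (by
    rw [Complex.normSq_neg, Complex.normSq_neg, RCLike.star_def, Complex.normSq_conj, Complex.normSq_conj, hr2])
  have hx : x = -(r * star (h.1 1 0)) := by
    have := congrArg star h1
    rw [star_neg, star_star, star_mul', RCLike.star_def, Complex.conj_ofReal] at this
    rw [RCLike.star_def, ← this, neg_neg]
  have hy : y = -(r * star (h.1 1 1)) := by
    have := congrArg star h2
    rw [star_neg, star_star, star_mul', RCLike.star_def, Complex.conj_ofReal] at this
    rw [RCLike.star_def, ← this, neg_neg]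
  have key : hor x y = r • Ad (block h⁻¹) (hor 0 (-1)) := by
    apply Subtype.ext
    rw [hx, hy, Submodule.coe_smul, Ad_block_coe, SU2.inv_coe, star_star]
    ext i j
    fin_cases i <;> fin_cases j <;>
      simp [hor, blockMatrix, Matrix.star_apply]
  rw [key, map_smul, map_smul, LinearMap.smul_apply, Q.invariant _ (memK_block _), ← hr2]
  simp only [smul_eq_mul, speedSq]
  ring

/-- The element `diag(-1, -1, 1)` of `K` acts as `1` on the Lie algebra of `K` and as `-1` on the
complement, so these two are orthogonal. -/
theorem form_hor_le (X : su3) :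
    (Complex.normSq (X.1 0 2) + Complex.normSq (X.1 1 2)) * Q.speedSq ≤ Q.form X X := by
  rw [← form_hor_self]
  set Y := hor (X.1 0 2) (X.1 1 2) with hY
  obtain ⟨V, hV⟩ : ∃ V, V = X - Y := ⟨_, rfl⟩
  have hX : X = V + Y := by rw [hV]; abel
  have hs := fun i j => congrFun (congrFun X.2.1 i) j
  have h20 : X.1 2 0 = -star (X.1 0 2) := by
    have := hs 2 0
    simp only [Matrix.star_apply, Matrix.neg_apply] at this
    rw [this, neg_neg]
  have h21 : X.1 2 1 = -star (X.1 1 2) := by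
    have := hs 2 1
    simp only [Matrix.star_apply, Matrix.neg_apply] at this
    rw [this, neg_neg]
  have eY : Ad (block (torusHom negOne)) Y = -Y := by
    apply Subtype.ext
    rw [Ad_block_torusHom_negOne_coe]
    ext i j
    rw [Matrix.mul_diagonal, Matrix.diagonal_mul]
    fin_cases i <;> fin_cases j <;> simp [hY, hor]
  have eV : Ad (block (torusHom negOne)) V = V := by
    apply Subtype.ext
    rw [Ad_block_torusHom_negOne_coe]
    ext i j
    rw [Matrix.mul_diagonal, Matrix.diagonal_mul]
    fin_cases i <;> fin_cases j <;> simp [hV, hY, hor, h20, h21]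
  have h0 : Q.form V Y = 0 := by
    have := Q.invariant _ (memK_block (torusHom negOne)) V Y
    rw [eY, eV, map_neg] at this
    linarith
  have hVn : 0 ≤ Q.form V V := by
    rcases eq_or_ne V 0 with h | h
    · rw [h]; simp
    · exact (Q.pos V h).le
  rw [hX]
  simp only [map_add, LinearMap.add_apply, h0, Q.symm Y V]
  linarith

theorem continuous_form : Continuous fun X : su3 => Q.form X X := by
  let b := Module.finBasis ℝ su3
  have h : (fun X : su3 => Q.form X X) =
      fun X => ∑ i, ∑ j, b.repr X i * (b.repr X j * Q.form (b i) (b j)) := by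
    funext X
    rw [← LinearMap.BilinForm.sum_repr_mul_repr_mul b X X]
    simp [Finsupp.sum_fintype]
  rw [h]
  have hb : ∀ i, Continuous fun X : su3 => b.repr X i := fun i =>
    LinearMap.continuous_of_finiteDimensional (b.coord i)
  exact continuous_finsetSum _ fun i _ => continuous_finsetSum _ fun j _ =>
    (hb i).mul ((hb j).mul continuous_const)

end InvariantMetric

/-! ### The distance from an orbit along a curve -/

/-- The angle `arcsin √f` changes at most by the integral of `n` if `|f'| ≤ 2 √f √(1 - f) n`. As
`arcsin √f` need not be differentiable where `f` is `0` or `1`, the estimate is obtained for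
`arcsin (√(f + δ) / (1 + δ))`, for which it still holds, and `δ` tends to `0`. -/
theorem abs_arcsin_sqrt_sub_le {f f' n : ℝ → ℝ} (hf0 : ∀ t, 0 ≤ f t) (hf1 : ∀ t, f t ≤ 1)
    (hc : ContinuousOn f (Set.Icc 0 1))
    (hd : ∀ t ∈ Set.Ioo (0 : ℝ) 1, HasDerivAt f (f' t) t)
    (hn : ContinuousOn n (Set.Icc 0 1))
    (h : ∀ t ∈ Set.Ioo (0 : ℝ) 1, |f' t| ≤ 2 * √(f t) * √(1 - f t) * n t)
    (hn0 : ∀ t, 0 ≤ n t) :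
    |Real.arcsin √(f 1) - Real.arcsin √(f 0)| ≤ ∫ t in (0 : ℝ)..1, n t := by
  have hint : MeasureTheory.IntegrableOn n (Set.Icc 0 1) := hn.integrableOn_Icc
  have main : ∀ δ ∈ Set.Ioi (0 : ℝ),
      |Real.arcsin (√(f 1 + δ) / (1 + δ)) - Real.arcsin (√(f 0 + δ) / (1 + δ))| ≤
        ∫ t in (0 : ℝ)..1, n t := by
    intro δ hδ
    replace hδ : 0 < δ := hδ
    set g : ℝ → ℝ := fun t => Real.arcsin (√(f t + δ) / (1 + δ)) with hg
    set g' : ℝ → ℝ := fun t =>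
      1 / √(1 - (√(f t + δ) / (1 + δ)) ^ 2) * (f' t / (2 * √(f t + δ)) / (1 + δ)) with hg'
    have hgc : ContinuousOn g (Set.Icc 0 1) :=
      Real.continuous_arcsin.comp_continuousOn
        ((Real.continuous_sqrt.comp_continuousOn (hc.add continuousOn_const)).div_const _)
    have hr2 : ∀ t, √(f t + δ) ^ 2 = f t + δ := fun t =>
      Real.sq_sqrt (by linarith [hf0 t])
    have hr : ∀ t, 0 < √(f t + δ) := fun t => Real.sqrt_pos.2 (by linarith [hf0 t])
    have hlt : ∀ t, (√(f t + δ) / (1 + δ)) ^ 2 < 1 := by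
      intro t
      rw [div_pow, hr2, div_lt_one (by positivity)]
      nlinarith [hf1 t]
    have hgd : ∀ t ∈ Set.Ioo (0 : ℝ) 1, HasDerivAt g (g' t) t := by
      intro t ht
      have h1 := ((hd t ht).add_const δ).sqrt (by linarith [hf0 t])
      have h2 := h1.div_const (1 + δ)
      refine (Real.hasDerivAt_arcsin ?_ ?_).comp t h2
      · intro h
        have := hlt t
        rw [h] at this
        norm_num at this
      · intro h
        have := hlt t
        rw [h] at this
        norm_num at this
    have hbound : ∀ t ∈ Set.Ioo (0 : ℝ) 1, |g' t| ≤ n t := by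
      intro t ht
      have hS : 0 < √(1 - (√(f t + δ) / (1 + δ)) ^ 2) := Real.sqrt_pos.2 (by linarith [hlt t])
      have hD : 0 < 1 + δ := by linarith
      have key : √(f t) * √(1 - f t) ≤
          √(1 - (√(f t + δ) / (1 + δ)) ^ 2) * √(f t + δ) * (1 + δ) := by
        refine abs_le_of_sq_le_sq' ?_ (by positivity) |>.2
        rw [mul_pow, mul_pow, mul_pow, Real.sq_sqrt (hf0 t), Real.sq_sqrt (by linarith [hf1 t]),
          Real.sq_sqrt (by linarith [hlt t]), hr2, div_pow, hr2]
        have e : (1 - (f t + δ) / (1 + δ) ^ 2) * (f t + δ) * (1 + δ) ^ 2 =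
            ((1 + δ) ^ 2 - (f t + δ)) * (f t + δ) := by field_simp
        rw [e, mul_comm]
        exact mul_le_mul (by nlinarith) (by linarith) (hf0 t) (by nlinarith [hf1 t])
      have hval : |g' t| = |f' t| / (√(1 - (√(f t + δ) / (1 + δ)) ^ 2) * (2 * √(f t + δ)) *
          (1 + δ)) := by
        rw [hg']
        simp only [abs_mul, abs_div, abs_one, abs_of_pos hS, abs_of_pos (hr t), abs_of_pos hD,
          abs_two]
        field_simp
      rw [hval, div_le_iff₀ (by have := hr t; positivity)]
      calc |f' t| ≤ 2 * √(f t) * √(1 - f t) * n t := h t ht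
        _ = n t * (2 * (√(f t) * √(1 - f t))) := by ring
        _ ≤ n t * (2 * (√(1 - (√(f t + δ) / (1 + δ)) ^ 2) * √(f t + δ) * (1 + δ))) :=
          mul_le_mul_of_nonneg_left (by linarith) (hn0 t)
        _ = _ := by ring
    have hup := intervalIntegral.sub_le_integral_of_hasDeriv_right_of_le zero_le_one hgc
      (fun t ht => (hgd t ht).hasDerivWithinAt) hint
      (fun t ht => (le_abs_self _).trans (hbound t ht))
    have hdown := intervalIntegral.sub_le_integral_of_hasDeriv_right_of_le zero_le_one hgc.neg
      (fun t ht => (hgd t ht).neg.hasDerivWithinAt) hint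
      (fun t ht => (neg_le_abs _).trans (hbound t ht))
    simp only [Pi.neg_apply] at hdown
    exact abs_le.2 ⟨by linarith, hup⟩
  have hlim : Filter.Tendsto
      (fun δ : ℝ => |Real.arcsin (√(f 1 + δ) / (1 + δ)) - Real.arcsin (√(f 0 + δ) / (1 + δ))|)
      (nhdsWithin 0 (Set.Ioi 0)) (nhds |Real.arcsin √(f 1) - Real.arcsin √(f 0)|) := by
    have hcont : ContinuousAt (fun δ : ℝ =>
        |Real.arcsin (√(f 1 + δ) / (1 + δ)) - Real.arcsin (√(f 0 + δ) / (1 + δ))|) 0 := by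
      have : ∀ s : ℝ, ContinuousAt (fun δ : ℝ => Real.arcsin (√(s + δ) / (1 + δ))) 0 := by
        intro s
        refine Real.continuous_arcsin.continuousAt.comp (ContinuousAt.div ?_ ?_ (by norm_num))
        · fun_prop
        · fun_prop
      exact ((this _).sub (this _)).abs
    have := hcont.tendsto
    simp only [add_zero, div_one] at this
    exact this.mono_left nhdsWithin_le_nhds
  exact le_of_tendsto hlim (Filter.eventually_of_mem self_mem_nhdsWithin main)

theorem SU3.normSq_corner_le_one (A : SU3) : Complex.normSq (A.1 2 2) ≤ 1 := by
  linarith [SU3.normSq_last_row A, Complex.normSq_nonneg (A.1 2 0),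
    Complex.normSq_nonneg (A.1 2 1)]

/-- The derivative of `|A₃₃|²` in the direction `A X` involves only the part of `X` orthogonal to
the Lie algebra of `K`, since `X₃₃` is imaginary. -/
theorem abs_deriv_normSq_corner_le (A : SU3) (X : su3) :
    |2 * ((A.1 2 2).re * ((A.1 * X.1) 2 2).re + (A.1 2 2).im * ((A.1 * X.1) 2 2).im)| ≤
      2 * √(Complex.normSq (A.1 2 2)) * √(1 - Complex.normSq (A.1 2 2)) *
        √(Complex.normSq (X.1 0 2) + Complex.normSq (X.1 1 2)) := by
  set d := A.1 2 2 with hd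
  set w := A.1 2 0 * X.1 0 2 + A.1 2 1 * X.1 1 2 with hw
  have h22 : (X.1 2 2).re = 0 := by
    have h := congrArg Complex.re (congrFun (congrFun X.2.1 2) 2)
    simp only [Matrix.star_apply, Matrix.neg_apply, RCLike.star_def, Complex.conj_re,
      Complex.neg_re] at h
    linarith
  have hAX : (A.1 * X.1) 2 2 = w + d * X.1 2 2 := by
    rw [Matrix.mul_apply, Fin.sum_univ_three]
  have h1 : d.re * ((A.1 * X.1) 2 2).re + d.im * ((A.1 * X.1) 2 2).im =
      (star d * w).re := by
    rw [hAX]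
    simp only [RCLike.star_def, Complex.add_re, Complex.add_im, Complex.mul_re, Complex.mul_im,
      Complex.conj_re, Complex.conj_im, h22]
    ring
  have h2 : |(star d * w).re| ≤ ‖d‖ * ‖w‖ := by
    refine (Complex.abs_re_le_norm _).trans ?_
    rw [norm_mul, norm_star]
  have h3 : ‖w‖ ≤ √(1 - Complex.normSq d) *
      √(Complex.normSq (X.1 0 2) + Complex.normSq (X.1 1 2)) := by
    have hrow : 1 - Complex.normSq d = ‖A.1 2 0‖ ^ 2 + ‖A.1 2 1‖ ^ 2 := by
      rw [← Complex.normSq_eq_norm_sq, ← Complex.normSq_eq_norm_sq]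
      linarith [SU3.normSq_last_row A]
    rw [hrow, Complex.normSq_eq_norm_sq, Complex.normSq_eq_norm_sq, ← Real.sqrt_mul (by positivity)]
    have ht : ‖w‖ ≤ ‖A.1 2 0‖ * ‖X.1 0 2‖ + ‖A.1 2 1‖ * ‖X.1 1 2‖ := by
      refine (norm_add_le _ _).trans ?_
      rw [norm_mul, norm_mul]
    refine ht.trans (Real.le_sqrt_of_sq_le ?_)
    nlinarith [sq_nonneg (‖A.1 2 0‖ * ‖X.1 1 2‖ - ‖A.1 2 1‖ * ‖X.1 0 2‖)]
  have hn : √(Complex.normSq d) = ‖d‖ := by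
    rw [Complex.normSq_eq_norm_sq, Real.sqrt_sq (norm_nonneg _)]
  rw [h1, abs_mul, abs_two, hn]
  calc 2 * |(star d * w).re| ≤ 2 * (‖d‖ * ‖w‖) := by linarith
    _ ≤ 2 * (‖d‖ * (√(1 - Complex.normSq d) *
        √(Complex.normSq (X.1 0 2) + Complex.normSq (X.1 1 2)))) := by
      have := mul_le_mul_of_nonneg_left h3 (norm_nonneg d)
      linarith
    _ = _ := by ring

/-- A curve in `SU(3)` is at least as long as the change of the angle `arccos |A₃₃|` along it, in
the unit given by the speed of `rot`. -/
theorem abs_arccos_sub_le_curveLength (Q : InvariantMetric) {γ : ℝ → SU3} {X : ℝ → su3}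
    (h : IsC1Curve γ X) :
    √Q.speedSq * |Real.arccos ‖(γ 0).1 2 2‖ - Real.arccos ‖(γ 1).1 2 2‖| ≤ curveLength Q X := by
  have ha : 0 < √Q.speedSq := Real.sqrt_pos.2 Q.speedSq_pos
  have hsq : ∀ A : SU3, √(Complex.normSq (A.1 2 2)) = ‖A.1 2 2‖ := fun A => by
    rw [Complex.normSq_eq_norm_sq, Real.sqrt_sq (norm_nonneg _)]
  have hn : ∀ t, √(Complex.normSq ((X t).1 0 2) + Complex.normSq ((X t).1 1 2)) ≤
      √(Q.form (X t) (X t)) / √Q.speedSq := by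
    intro t
    rw [le_div_iff₀ ha, ← Real.sqrt_mul (add_nonneg (Complex.normSq_nonneg _)
      (Complex.normSq_nonneg _))]
    exact Real.sqrt_le_sqrt (Q.form_hor_le (X t))
  have hcurve : ∀ t ∈ Set.Icc (0 : ℝ) 1, HasDerivWithinAt (fun s => Complex.normSq ((γ s).1 2 2))
      (2 * (((γ t).1 2 2).re * (((γ t).1 * (X t).1) 2 2).re +
        ((γ t).1 2 2).im * (((γ t).1 * (X t).1) 2 2).im)) (Set.Icc 0 1) t := by
    intro t ht
    have hd := h.2 t ht 2 2
    have hre := Complex.reCLM.hasFDerivAt.comp_hasDerivWithinAt t hd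
    have him := Complex.imCLM.hasFDerivAt.comp_hasDerivWithinAt t hd
    refine ((hre.mul hre).add (him.mul him)).congr_deriv ?_
    simp only [Function.comp_apply, Complex.reCLM_apply, Complex.imCLM_apply]
    ring
  have key := abs_arcsin_sqrt_sub_le (f := fun s => Complex.normSq ((γ s).1 2 2))
    (n := fun t => √(Q.form (X t) (X t)) / √Q.speedSq)
    (fun t => Complex.normSq_nonneg _) (fun t => SU3.normSq_corner_le_one _)
    (fun t ht => (hcurve t ht).continuousWithinAt)
    (fun t ht => (hcurve t (Set.Ioo_subset_Icc_self ht)).hasDerivAt (Icc_mem_nhds ht.1 ht.2))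
    ((Real.continuous_sqrt.comp_continuousOn
      (Q.continuous_form.comp_continuousOn h.1)).div_const _)
    (fun t _ => (abs_deriv_normSq_corner_le (γ t) (X t)).trans
      (mul_le_mul_of_nonneg_left (hn t) (by positivity)))
    (fun t => by positivity)
  rw [intervalIntegral.integral_div, le_div_iff₀ ha] at key
  simp only [hsq] at key
  simp only [Real.arccos]
  rw [mul_comm, sub_sub_sub_cancel_left]
  exact key

/-! ### The orbit space -/

/-- The function `|A₃₃|` on `E_p`. -/
def cornerNorm (p : ℤ) : E p → ℝ :=
  Quotient.lift (fun A : SU3 => ‖A.1 2 2‖) (by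
    rintro A B ⟨z, h⟩
    simp [h, circleDiag, Matrix.mul_diagonal, Matrix.diagonal_mul, Circle.norm_coe])

theorem cornerNorm_proj (p : ℤ) (A : SU3) : cornerNorm p (proj p A) = ‖A.1 2 2‖ := rfl

theorem continuous_cornerNorm (p : ℤ) : Continuous (cornerNorm p) := by
  refine Continuous.quotient_lift (Continuous.norm ?_) _
  exact continuous_subtype_val.matrix_elem 2 2

theorem cornerNorm_smul (p : ℤ) (g : G) (x : E p) : cornerNorm p (g • x) = cornerNorm p x := by
  obtain ⟨A, rfl⟩ := proj_surjective p x
  rw [smul_proj, ← map_inv, cornerNorm_proj, cornerNorm_proj]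
  change ‖(blockMatrix g.1.1 * A.1 * blockMatrix (g.2⁻¹).1) 2 2‖ = _
  simp [blockMatrix, Matrix.mul_apply, Fin.sum_univ_three, Matrix.vecMul, dotProduct]

theorem arccos_cornerNorm_rot (p : ℤ) {θ : ℝ} (hθ : θ ∈ Set.Icc 0 (Real.pi / 2)) :
    Real.arccos (cornerNorm p (proj p (rot θ))) = θ := by
  have hc : 0 ≤ Real.cos θ := Real.cos_nonneg_of_mem_Icc ⟨by linarith [hθ.1, Real.pi_pos], hθ.2⟩
  have : cornerNorm p (proj p (rot θ)) = Real.cos θ := by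
    simp [cornerNorm_proj, rot, -Complex.ofReal_cos, abs_of_nonneg hc]
  rw [this, Real.arccos_cos hθ.1 (by linarith [hθ.2, Real.pi_pos])]

/-- The distance in `E_p` is at least the difference of the angles `arccos |A₃₃|` of the orbits, in
the unit given by the speed of `rot`. -/
theorem arccos_cornerNorm_le_quotientEDist (Q : InvariantMetric) {p : ℤ} (x y : E p) :
    ENNReal.ofReal
      (√Q.speedSq * |Real.arccos (cornerNorm p x) - Real.arccos (cornerNorm p y)|) ≤
        quotientEDist Q x y := by
  refine le_iInf fun γ => le_iInf fun X => le_iInf fun h => le_iInf fun h0 => le_iInf fun h1 => ?_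
  rw [← h0, ← h1, cornerNorm_proj, cornerNorm_proj]
  exact ENNReal.ofReal_le_ofReal (abs_arccos_sub_le_curveLength Q h)

theorem hasDerivAt_rot (θ : ℝ) (i j : Fin 3) :
    HasDerivAt (fun s => (rot s).1 i j) (((rot θ).1 * (hor 0 (-1)).1) i j) θ := by
  have hc := (Real.hasDerivAt_cos θ).ofReal_comp
  have hs := (Real.hasDerivAt_sin θ).ofReal_comp
  have hk := fun c : ℂ => hasDerivAt_const θ c
  fin_cases i <;> fin_cases j <;>
    simp [rot, hor, Matrix.mul_apply, Fin.sum_univ_three, -Complex.ofReal_cos,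
      -Complex.ofReal_sin, hk]
  all_goals first | exact hs | exact hs.neg | simpa [-Complex.ofReal_sin] using hc

theorem isC1Curve_rot (a b : ℝ) :
    IsC1Curve (fun t => rot (a + t * (b - a))) (fun _ => (b - a) • hor 0 (-1)) := by
  refine ⟨continuousOn_const, fun t _ i j => HasDerivAt.hasDerivWithinAt ?_⟩
  have h1 : HasDerivAt (fun s : ℝ => a + s * (b - a)) (b - a) t := by
    simpa using ((hasDerivAt_id t).mul_const (b - a)).const_add a
  have := (hasDerivAt_rot (a + t * (b - a)) i j).scomp t h1
  rw [Submodule.coe_smul, Matrix.mul_smul]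
  exact this

/-- The curve `rot` realizes the distance between orbits: it has constant speed and its angle
changes monotonically, so the lower bound for lengths is attained. -/
theorem quotientEDist_rot (Q : InvariantMetric) (p : ℤ) {a b : ℝ}
    (ha : a ∈ Set.Icc 0 (Real.pi / 2)) (hb : b ∈ Set.Icc 0 (Real.pi / 2)) :
    quotientEDist Q (proj p (rot a)) (proj p (rot b)) =
      ENNReal.ofReal (√Q.speedSq * |a - b|) := by
  refine le_antisymm ?_ ?_
  · refine iInf_le_of_le _ (iInf_le_of_le _ (iInf_le_of_le (isC1Curve_rot a b)
      (iInf_le_of_le (by simp) (iInf_le_of_le (by simp) (le_of_eq ?_)))))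
    congr 1
    simp only [curveLength, map_smul, LinearMap.smul_apply, smul_eq_mul,
      intervalIntegral.integral_const, sub_zero, one_mul]
    change √((b - a) * ((b - a) * Q.speedSq)) = _
    rw [← mul_assoc, Real.sqrt_mul (mul_self_nonneg _), Real.sqrt_mul_self_eq_abs, abs_sub_comm,
      mul_comm]
  · have := arccos_cornerNorm_le_quotientEDist Q (proj p (rot a)) (proj p (rot b))
    rwa [arccos_cornerNorm_rot p ha, arccos_cornerNorm_rot p hb] at this

/-- The function `|A₃₃|` on the orbit space. -/
def orbitCornerNorm (p : ℤ) : OrbitSpace p → ℝ :=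
  Quotient.lift (cornerNorm p) (by
    rintro x y ⟨g, rfl⟩
    exact cornerNorm_smul p g y)

theorem orbitCornerNorm_orbitClass (p : ℤ) (x : E p) :
    orbitCornerNorm p (orbitClass x) = cornerNorm p x := rfl

theorem continuous_orbitCornerNorm (p : ℤ) : Continuous (orbitCornerNorm p) :=
  (continuous_cornerNorm p).quotient_lift _

theorem orbitClass_smul {p : ℤ} (g : G) (x : E p) : orbitClass (g • x) = orbitClass x :=
  Quotient.sound (s := MulAction.orbitRel G (E p)) ⟨g, rfl⟩

theorem orbitClass_rot_orbitCornerNorm (p : ℤ) (y : OrbitSpace p) :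
    orbitClass (proj p (rot (Real.arccos (orbitCornerNorm p y)))) = y := by
  obtain ⟨x, rfl⟩ := Quotient.mk_surjective y
  obtain ⟨A, rfl⟩ := proj_surjective p x
  obtain ⟨g, hg⟩ := exists_smul_proj_rot p A
  change _ = orbitClass (proj p A)
  conv_rhs => rw [hg]
  rw [orbitClass_smul]
  rfl

theorem orbitCornerNorm_nonneg (p : ℤ) (y : OrbitSpace p) : 0 ≤ orbitCornerNorm p y := by
  obtain ⟨x, rfl⟩ := Quotient.mk_surjective y
  obtain ⟨A, rfl⟩ := proj_surjective p x
  exact norm_nonneg _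

/-! ### The geodesic between the singular orbits -/

theorem exists_geodesic (p : ℤ) (Q : InvariantMetric) : ∃ L : ℝ, 0 < L ∧ ∃ c : ℝ → E p,
    IsMinimalGeodesicBetweenOrbits Q L c ∧
    IsHomeomorph (fun t : Set.Icc (0 : ℝ) L => orbitClass (c t)) ∧
    MulAction.stabilizer G (c 0) = Kminus p ∧
    MulAction.stabilizer G (c L) = Kplus p ∧
    ∀ t ∈ Set.Ioo 0 L, MulAction.stabilizer G (c t) = Hgroup p := by
  set v := √Q.speedSq with hv
  have hv0 : 0 < v := Real.sqrt_pos.2 Q.speedSq_pos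
  have hpi := Real.pi_pos
  have hmem : ∀ t ∈ Set.Icc 0 (v * (Real.pi / 2)), t / v ∈ Set.Icc 0 (Real.pi / 2) :=
    fun t ht => ⟨div_nonneg ht.1 hv0.le, (div_le_iff₀' hv0).2 ht.2⟩
  have hL : v * (Real.pi / 2) / v = Real.pi / 2 := by field_simp
  have hL0 : 0 < v * (Real.pi / 2) := by positivity
  refine ⟨v * (Real.pi / 2), hL0, fun t => proj p (rot (t / v)), ⟨?_, ?_⟩, ?_, ?_, ?_, ?_⟩
  · intro s hs t ht
    rw [quotientEDist_rot Q p (hmem s hs) (hmem t ht), ← sub_div, abs_div, abs_of_pos hv0,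
      ← hv, mul_div_cancel₀ _ hv0.ne']
  · rintro _ ⟨g, rfl⟩ _ ⟨h, rfl⟩
    refine le_trans (le_of_eq ?_) (arccos_cornerNorm_le_quotientEDist Q _ _)
    simp only [cornerNorm_smul]
    rw [arccos_cornerNorm_rot p (hmem _ ⟨le_rfl, hL0.le⟩),
      arccos_cornerNorm_rot p (hmem _ ⟨hL0.le, le_rfl⟩), zero_div, zero_sub, abs_neg, hL,
      abs_of_pos (by positivity)]
  · rw [isHomeomorph_iff_exists_inverse]
    refine ⟨?_, fun y => ⟨v * Real.arccos (orbitCornerNorm p y),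
      mul_nonneg hv0.le (Real.arccos_nonneg _), mul_le_mul_of_nonneg_left
        (Real.arccos_le_pi_div_two.2 (orbitCornerNorm_nonneg p y)) hv0.le⟩, ?_, ?_, ?_⟩
    · exact continuous_quotient_mk'.comp ((continuous_proj p).comp
        (continuous_rot.comp (continuous_subtype_val.div_const v)))
    · rintro ⟨t, ht⟩
      apply Subtype.ext
      simp only [orbitCornerNorm_orbitClass]
      rw [arccos_cornerNorm_rot p (hmem t ht), mul_div_cancel₀ _ hv0.ne']
    · intro y
      simp only [mul_div_cancel_left₀ _ hv0.ne']
      exact orbitClass_rot_orbitCornerNorm p y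
    · exact ((Real.continuous_arccos.comp (continuous_orbitCornerNorm p)).const_mul v).subtype_mk _
  · simp only [zero_div]
    exact stabilizer_rot_zero p
  · simp only [hL]
    exact stabilizer_rot_pi_div_two p
  · intro t ht
    have h0 : 0 < t / v := div_pos ht.1 hv0
    have h1 : t / v < Real.pi / 2 := (div_lt_iff₀' hv0).2 ht.2
    exact stabilizer_rot_of_ne (Real.sin_pos_of_pos_of_lt_pi h0 (by linarith)).ne'
      (Real.cos_pos_of_mem_Ioo ⟨by linarith, h1⟩).ne'

end

end CohomOne

theorem mainTheorem10 (p : ℤ) (hp : 0 < p) :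
    -- `H` is of order two, and is the principal isotropy group
    Nonempty (Hgroup p ≃* Multiplicative (ZMod 2)) ∧
    (∀ K : Subgroup G, IsPrincipalIsotropy (E p) K ↔ K = Hgroup p) ∧
    -- `K⁺` is an embedded circle in a maximal torus
    (IsMaximalTorus standardTorus ∧ Kplus p ≤ standardTorus ∧
      Function.Injective (slopeHom (p + 1) p)) ∧
    -- the singular isotropy groups are `K⁻` and `K⁺`, up to conjugation
    (∀ K : Subgroup G, IsSingularIsotropy (E p) K ↔
      ∃ g : G, K = conj g (Kminus p) ∨ K = conj g (Kplus p)) ∧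
    -- the group diagram: for each of the metrics, the isotropy groups along a minimal geodesic
    -- between the two non-principal orbits, which parametrizes the orbit space
    (∀ Q : InvariantMetric, ∃ L : ℝ, 0 < L ∧ ∃ c : ℝ → E p,
      IsMinimalGeodesicBetweenOrbits Q L c ∧
      IsHomeomorph (fun t : Set.Icc (0 : ℝ) L => orbitClass (c t)) ∧
      MulAction.stabilizer G (c 0) = Kminus p ∧
      MulAction.stabilizer G (c L) = Kplus p ∧
      ∀ t ∈ Set.Ioo 0 L, MulAction.stabilizer G (c t) = Hgroup p) := by
  exact ⟨Hgroup_mulEquiv p, isPrincipalIsotropy_iff p,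
    ⟨isMaximalTorus_standardTorus, Kplus_le_standardTorus p, slopeHom_injective p⟩,
    isSingularIsotropy_iff p, exists_geodesic p⟩
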